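/- Let $U\subset\mathbb{R}^n$ be open and let $g:U\to\mathbb{R}^n\setminus\{0\}$ be locally Lipschitz (that is, Lipschitz on every compact subset of $U$). A function $u:V\to\mathbb{R}$ is called a normal solution to the total differential equation $\nabla u(x)=\lambda(x)g(x)$ if 1) its domain $V$ is an open subset of $U$; 2) $u$ is locally Lipschitz on $V$; 3) every level set of $u$ is an $(n-1)$-dimensional $C^1$ submanifold of $\mathbb{R}^n$; 4) $g$ is normal to every level set of $u$, i.e. $g(x)\cdot v=0$ for every $x\in V$ and every $v$ in the tangent space at $x$ of $u^{-1}(u(x))$; 5) $u$ has no local maximum point and no local minimum point in $V$; and 6) $\nabla u(x)\neq 0$ at every $x\in V$ at which $u$ is differentiable. Suppose that $u_1$ and $u_2$ are two normal solutions (for the same $g$) defined on the same connected domain $V$, and that every level set of $u_1$ and every level set of $u_2$ is connected. Then $u_2$ is a monotone transform of $u_1$ on $V$: there is a function $\phi:u_1(V)\to\mathbb{R}$, either strictly increasing or strictly decreasing, such that $u_2(x)=\phi(u_1(x))$ for all $x\in V$. -/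

import Mathlib

open Set

namespace TDE

/-- `f` is locally Lipschitz on the (open) set `U`: it is Lipschitz on every compact subset of `U`. -/
def LocLipschitzOn {E F : Type*} [PseudoEMetricSpace E] [PseudoEMetricSpace F]
    (f : E → F) (U : Set E) : Prop :=
  ∀ C : Set E, C ⊆ U → IsCompact C → ∃ L : NNReal, LipschitzOnWith L f C

/-- `f : X → ℝ^M` is `C^k` on an arbitrary subset `X` of `ℝ^N`: near each point of `X` it is the
restriction of a `C^k` map defined on a ball of `ℝ^N`. -/
def IsCkOn (k : WithTop ℕ∞) {N M : ℕ} (X : Set (EuclideanSpace ℝ (Fin N)))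
    (f : EuclideanSpace ℝ (Fin N) → EuclideanSpace ℝ (Fin M)) : Prop :=
  ∀ x ∈ X, ∃ r : ℝ, 0 < r ∧ ∃ F : EuclideanSpace ℝ (Fin N) → EuclideanSpace ℝ (Fin M),
    ContDiffOn ℝ k F (Metric.ball x r) ∧ ∀ y ∈ X ∩ Metric.ball x r, F y = f y

/-- `f` restricts to a `C^k` diffeomorphism from `X` onto `Y`. -/
def IsCkDiffeoOn (k : WithTop ℕ∞) {N M : ℕ}
    (f : EuclideanSpace ℝ (Fin N) → EuclideanSpace ℝ (Fin M))
    (X : Set (EuclideanSpace ℝ (Fin N))) (Y : Set (EuclideanSpace ℝ (Fin M))) : Prop :=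
  BijOn f X Y ∧ IsCkOn k X f ∧
    ∃ h : EuclideanSpace ℝ (Fin M) → EuclideanSpace ℝ (Fin N), InvOn h f X Y ∧ IsCkOn k Y h

/-- `φ : W → O` is a `C^k` local parametrization of `X ⊆ ℝ^N` around `x`: `W` is open in `ℝ^m`,
`O` is a relatively open subset of `X` containing `x`, and `φ` is a `C^k` diffeomorphism of `W`
onto `O`. -/
structure IsLocalParam (k : WithTop ℕ∞) {m N : ℕ} (X : Set (EuclideanSpace ℝ (Fin N)))
    (x : EuclideanSpace ℝ (Fin N)) (φ : EuclideanSpace ℝ (Fin m) → EuclideanSpace ℝ (Fin N))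
    (W : Set (EuclideanSpace ℝ (Fin m))) (O : Set (EuclideanSpace ℝ (Fin N))) : Prop where
  isOpen_source : IsOpen W
  relOpen_target : ∃ G : Set (EuclideanSpace ℝ (Fin N)), IsOpen G ∧ O = X ∩ G
  mem_target : x ∈ O
  diffeo : IsCkDiffeoOn k φ W O

/-- `X ⊆ ℝ^N` is an `m`-dimensional `C^k` manifold (regular submanifold of `ℝ^N`). -/
def IsCkManifold (k : WithTop ℕ∞) (m : ℕ) {N : ℕ} (X : Set (EuclideanSpace ℝ (Fin N))) : Prop :=
  ∀ x ∈ X, ∃ (φ : EuclideanSpace ℝ (Fin m) → EuclideanSpace ℝ (Fin N))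
    (W : Set (EuclideanSpace ℝ (Fin m))) (O : Set (EuclideanSpace ℝ (Fin N))),
    IsLocalParam k X x φ W O

/-- The tangent space at `x` of an `m`-dimensional `C^1` manifold `X`: the range of `Dφ(w)` for a
local parametrization `φ` with `φ(w) = x`. This range does not depend on `φ`, so that the
existential over `φ` below is the usual definition. -/
def tangentSpace (m : ℕ) {N : ℕ} (X : Set (EuclideanSpace ℝ (Fin N)))
    (x : EuclideanSpace ℝ (Fin N)) : Set (EuclideanSpace ℝ (Fin N)) :=
  {v | ∃ (φ : EuclideanSpace ℝ (Fin m) → EuclideanSpace ℝ (Fin N))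
    (W : Set (EuclideanSpace ℝ (Fin m))) (O : Set (EuclideanSpace ℝ (Fin N))),
    IsLocalParam 1 X x φ W O ∧ ∃ w ∈ W, φ w = x ∧ v ∈ range (fderiv ℝ φ w)}

/-- `g` is a normal vector field of the `m`-dimensional `C^1` manifold `X`. -/
def IsNormalField (m : ℕ) {N : ℕ} (X : Set (EuclideanSpace ℝ (Fin N)))
    (g : EuclideanSpace ℝ (Fin N) → EuclideanSpace ℝ (Fin N)) : Prop :=
  ∀ x ∈ X, ∀ v ∈ tangentSpace m X x, inner ℝ (g x) v = 0

/-- The level set at height `c` of the function `u` with domain `V`. -/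
def levelSet {E : Type*} (V : Set E) (u : E → ℝ) (c : ℝ) : Set E := {x | x ∈ V ∧ u x = c}

/-- `u : V → ℝ` is a normal solution of `∇u(x) = λ(x) g(x)`, where `g` has domain `U`. Only the
values of `u` on `V` and of `g` on `U` matter. -/
structure IsNormalSolution {n : ℕ} (U : Set (EuclideanSpace ℝ (Fin n)))
    (g : EuclideanSpace ℝ (Fin n) → EuclideanSpace ℝ (Fin n))
    (V : Set (EuclideanSpace ℝ (Fin n))) (u : EuclideanSpace ℝ (Fin n) → ℝ) : Prop where
  isOpen_domain : IsOpen V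
  domain_subset : V ⊆ U
  locLipschitz : LocLipschitzOn u V
  manifold_levelSet : ∀ c : ℝ, IsCkManifold 1 (n - 1) (levelSet V u c)
  normal_levelSet : ∀ c : ℝ, IsNormalField (n - 1) (levelSet V u c) g
  no_localMax : ∀ x ∈ V, ¬ IsLocalMax u x
  no_localMin : ∀ x ∈ V, ¬ IsLocalMin u x
  gradient_ne_zero : ∀ x ∈ V, DifferentiableAt ℝ u x → gradient u x ≠ 0

/-- `u₂` is a monotone (increasing, or decreasing, both in the strict sense) transform of `u₁`
on `V`. -/
def IsMonotoneTransformOn {E : Type*} (V : Set E) (u₁ u₂ : E → ℝ) : Prop :=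
  ∃ φ : ℝ → ℝ, (StrictMonoOn φ (u₁ '' V) ∨ StrictAntiOn φ (u₁ '' V)) ∧
    ∀ x ∈ V, u₂ x = φ (u₁ x)

end TDE

/-! Level sets of both solutions are integral hypersurfaces of the hyperplane field normal to `g`.
As `g` is Lipschitz, two such hypersurfaces through a point agree near it
(`eventually_mem_of_isNormalField`): the displacement from one to the other along a fixed direction
satisfies a linear differential inequality, so Grönwall makes it zero. Hence `u₂` is locally
constant on each level set of `u₁`, and by connectedness constant (`eq_of_eq`). By symmetry `u₂ = φ
∘ u₁` with `φ` injective on `u₁ '' V`, an interval. Having no local extrema, `u₁` is open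
(`image_mem_nhds`), so `φ` inherits continuity from `u₂`; a continuous injection on an interval is
strictly monotone. -/

namespace TDE

open Filter Topology

/-! ### Local uniqueness of integral hypersurfaces -/

section LocalUniqueness

variable {E F : Type*} [NormedAddCommGroup E] [InnerProductSpace ℝ E]
  [NormedAddCommGroup F] [NormedSpace ℝ F]

/-- Grönwall's inequality along rays: a map whose derivative is controlled by its value, and which
vanishes at the centre of a ball, vanishes on the ball. -/
lemma eq_zero_of_norm_fderiv_le {h : F → E} {w₀ : F} {r K : ℝ}
    (hd : ∀ w ∈ Metric.ball w₀ r, DifferentiableAt ℝ h w)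
    (hK : ∀ w ∈ Metric.ball w₀ r, ∀ v, ‖fderiv ℝ h w v‖ ≤ K * ‖h w‖ * ‖v‖)
    (h0 : h w₀ = 0) {w : F} (hw : w ∈ Metric.ball w₀ r) : h w = 0 := by
  have hmem : ∀ t ∈ Icc (0 : ℝ) 1, w₀ + t • (w - w₀) ∈ Metric.ball w₀ r := by
    intro t ht
    have hr : 0 < r := Metric.pos_of_mem_ball hw
    exact (convex_ball w₀ r).add_smul_sub_mem (Metric.mem_ball_self hr) hw ht
  have hder : ∀ t ∈ Icc (0 : ℝ) 1, HasDerivAt (fun t : ℝ => h (w₀ + t • (w - w₀)))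
      (fderiv ℝ h (w₀ + t • (w - w₀)) (w - w₀)) t := by
    intro t ht
    have h1 : HasDerivAt (fun t : ℝ => w₀ + t • (w - w₀)) (w - w₀) t := by
      simpa using ((hasDerivAt_id t).smul_const (w - w₀)).const_add w₀
    exact (hd _ (hmem t ht)).hasFDerivAt.comp_hasDerivAt t h1
  have key := eq_zero_of_abs_deriv_le_mul_abs_self_of_eq_zero_right
    (f := fun t : ℝ => h (w₀ + t • (w - w₀)))
    (f' := fun t => fderiv ℝ h (w₀ + t • (w - w₀)) (w - w₀)) (K := K * ‖w - w₀‖) (a := 0) (b := 1)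
    (fun t ht => (hder t ht).continuousAt.continuousWithinAt)
    (fun t ht => (hder t (Ico_subset_Icc_self ht)).hasDerivWithinAt) (by simpa using h0)
    (fun t ht => by
      refine (hK _ (hmem t (Ico_subset_Icc_self ht)) _).trans_eq ?_
      ring)
  simpa using key 1 (by simp)

lemma ContDiffAt.eventually_norm_fderiv_le {E F : Type*} [NormedAddCommGroup E] [NormedSpace ℝ E]
    [NormedAddCommGroup F] [NormedSpace ℝ F] {f : F → E} {x : F} (hf : ContDiffAt ℝ 1 f x) :
    ∃ M : ℝ, 0 ≤ M ∧ ∀ᶠ y in 𝓝 x, DifferentiableAt ℝ f y ∧ ‖fderiv ℝ f y‖ ≤ M := by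
  refine ⟨‖fderiv ℝ f x‖ + 1, by positivity, ?_⟩
  have h1 : ContinuousAt (fun y => ‖fderiv ℝ f y‖) x :=
    (hf.continuousAt_fderiv (by simp)).norm
  filter_upwards [h1.eventually (gt_mem_nhds (lt_add_one _)), hf.eventually (by simp)] with y hy hy'
  exact ⟨hy'.differentiableAt (by simp), hy.le⟩

/-- Two integral surfaces of the field of hyperplanes normal to a Lipschitz field `g`, passing
through the same point `φ w₀`, coincide near that point. The second surface is described by a
retraction `Q` onto it along `g (φ w₀)`. -/
lemma eventually_retraction_eq {g Q : E → E} {φ : F → E} {w₀ : F}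
    {s : Set E} {L : NNReal} (hs : s ∈ 𝓝 (φ w₀)) (hg : LipschitzOnWith L g s)
    (hg0 : g (φ w₀) ≠ 0)
    (hφ : ContDiffAt ℝ 1 φ w₀) (hφn : ∀ᶠ w in 𝓝 w₀, ∀ v, inner ℝ (g (φ w)) (fderiv ℝ φ w v) = 0)
    (hQ : ContDiffAt ℝ 1 Q (φ w₀)) (hQ0 : Q (φ w₀) = φ w₀)
    (hQn : ∀ᶠ y in 𝓝 (φ w₀), ∀ v, inner ℝ (g (Q y)) (fderiv ℝ Q y v) = 0)
    (hQa : ∀ᶠ y in 𝓝 (φ w₀), ∃ c : ℝ, y - Q y = c • g (φ w₀)) :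
    ∀ᶠ w in 𝓝 w₀, Q (φ w) = φ w := by
  set a := g (φ w₀)
  have ha0 : 0 < ‖a‖ := norm_pos_iff.2 hg0
  obtain ⟨M, hM0, hM⟩ := ContDiffAt.eventually_norm_fderiv_le hφ
  obtain ⟨N, hN0, hN⟩ := ContDiffAt.eventually_norm_fderiv_le hQ
  have hφc : Tendsto φ (𝓝 w₀) (𝓝 (φ w₀)) := hφ.continuousAt
  have hQc : Tendsto Q (𝓝 (φ w₀)) (𝓝 (φ w₀)) := by
    simpa only [hQ0] using hQ.continuousAt.tendsto
  have hgc : ContinuousAt g (φ w₀) := hg.continuousOn.continuousAt hs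
  -- Keeps `g` transverse to `a`, so that a multiple of `a` is controlled by its inner product with
  -- `g`.
  have hga : ∀ᶠ y in 𝓝 (φ w₀), ‖a‖ ^ 2 / 2 < inner ℝ (g y) a := by
    have h1 : ContinuousAt (fun y => inner ℝ (g y) a) (φ w₀) := hgc.inner continuousAt_const
    refine h1.eventually (lt_mem_nhds ?_)
    change ‖a‖ ^ 2 / 2 < inner ℝ a a
    rw [real_inner_self_eq_norm_sq]
    nlinarith
  have hall := (hM.and hφn).and (hφc.eventually ((hN.and hQn).and
    ((hQa.and hga).and (Filter.Eventually.and hs (hQc.eventually hs)))))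
  obtain ⟨r, hr, hball⟩ := Metric.eventually_nhds_iff_ball.1 hall
  set h : F → E := fun w => φ w - Q (φ w) with hh
  have hder : ∀ w ∈ Metric.ball w₀ r, HasFDerivAt h
      (fderiv ℝ φ w - (fderiv ℝ Q (φ w)).comp (fderiv ℝ φ w)) w := by
    intro w hw
    obtain ⟨⟨⟨h1, -⟩, -⟩, ⟨⟨h2, -⟩, -⟩, -⟩ := hball w hw
    exact h1.hasFDerivAt.sub (h2.hasFDerivAt.comp w h1.hasFDerivAt)
  -- Orthogonal projection onto the line through `a`. Since `h = T ∘ h`, the derivative of `h` also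
  -- takes values in that line.
  let T : E →L[ℝ] E := ((‖a‖ ^ 2)⁻¹ • innerSL ℝ a).smulRight a
  have hT : ∀ w ∈ Metric.ball w₀ r, h w = T (h w) := by
    intro w hw
    obtain ⟨-, -, ⟨⟨c, hc⟩, -⟩, -⟩ := hball w hw
    simp only [hh, hc, T, ContinuousLinearMap.smulRight_apply, smul_apply,
      innerSL_apply_apply, inner_smul_right, real_inner_self_eq_norm_sq, smul_eq_mul]
    congr 1
    field_simp
  have key : ∀ w ∈ Metric.ball w₀ r, ∀ v,
      ‖fderiv ℝ h w v‖ ≤ (2 / ‖a‖ * L * N * M) * ‖h w‖ * ‖v‖ := by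
    intro w hw v
    obtain ⟨⟨⟨-, hM⟩, hφn⟩, ⟨⟨-, hN⟩, hQn⟩, ⟨-, hga⟩, hs1, hs2⟩ := hball w hw
    obtain ⟨d, hd⟩ : ∃ d : ℝ, fderiv ℝ h w v = d • a := by
      have h1 : HasFDerivAt h (T.comp (fderiv ℝ h w)) w := by
        refine (T.hasFDerivAt.comp w (hder w hw).differentiableAt.hasFDerivAt).congr_of_eventuallyEq
          ?_
        filter_upwards [Metric.isOpen_ball.mem_nhds hw] with z hz using hT z hz
      exact ⟨_, by rw [h1.fderiv]; rfl⟩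
    -- Each surface is orthogonal to `g` at its own point, so only the variation of `g` between the
    -- two points survives; it is at most `L * ‖h w‖`.
    have h2 : inner ℝ (g (φ w)) (fderiv ℝ h w v) =
        - inner ℝ (g (φ w) - g (Q (φ w))) (fderiv ℝ Q (φ w) (fderiv ℝ φ w v)) := by
      rw [(hder w hw).fderiv, inner_sub_left, hQn]
      simp [inner_sub_right, hφn]
    have h3 : |inner ℝ (g (φ w)) (fderiv ℝ h w v)| ≤ (L * ‖h w‖) * (N * (M * ‖v‖)) := by
      rw [h2, abs_neg]
      refine (abs_real_inner_le_norm _ _).trans ?_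
      have h4 : ‖g (φ w) - g (Q (φ w))‖ ≤ L * ‖h w‖ := hg.norm_sub_le hs1 hs2
      have h5 : ‖fderiv ℝ Q (φ w) (fderiv ℝ φ w v)‖ ≤ N * (M * ‖v‖) :=
        ((fderiv ℝ Q (φ w)).le_of_opNorm_le hN _).trans
          (mul_le_mul_of_nonneg_left ((fderiv ℝ φ w).le_of_opNorm_le hM _) hN0)
      exact mul_le_mul h4 h5 (norm_nonneg _) (by positivity)
    rw [hd, inner_smul_right, abs_mul] at h3
    rw [hd, norm_smul, Real.norm_eq_abs]
    have h6 : |d| * (‖a‖ ^ 2 / 2) ≤ (L * ‖h w‖) * (N * (M * ‖v‖)) :=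
      (mul_le_mul_of_nonneg_left (hga.le.trans (le_abs_self _)) (abs_nonneg d)).trans h3
    have h7 : |d| * ‖a‖ = 2 / ‖a‖ * (|d| * (‖a‖ ^ 2 / 2)) := by field_simp
    rw [h7]
    refine (mul_le_mul_of_nonneg_left h6 (by positivity)).trans_eq ?_
    ring
  filter_upwards [Metric.ball_mem_nhds w₀ hr] with w hw
  have := eq_zero_of_norm_fderiv_le (fun w hw => (hder w hw).differentiableAt) key
    (by simp [hh, hQ0]) hw
  exact (sub_eq_zero.1 this).symm

end LocalUniqueness

/-- An immersed hypersurface is locally a graph over its tangent space: near the point `φ w₀` there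
is a `C¹` projection onto it along the normal direction `a`. -/
lemma exists_projection_along_normal {E F : Type*} [NormedAddCommGroup E] [InnerProductSpace ℝ E]
    [FiniteDimensional ℝ E] [NormedAddCommGroup F] [InnerProductSpace ℝ F] [FiniteDimensional ℝ F]
    (hdim : Module.finrank ℝ E = Module.finrank ℝ F + 1) {φ : F → E} {w₀ : F}
    (hφ : ContDiffAt ℝ 1 φ w₀) (hinj : Function.Injective (fderiv ℝ φ w₀)) {a : E} (ha0 : a ≠ 0)
    (ha : ∀ v, inner ℝ a (fderiv ℝ φ w₀ v) = 0) :
    ∃ ψ : E → F, ContDiffAt ℝ 1 ψ (φ w₀) ∧ ψ (φ w₀) = w₀ ∧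
      ∀ᶠ y in 𝓝 (φ w₀), ∃ c : ℝ, y - φ (ψ y) = c • a := by
  have : CompleteSpace E := FiniteDimensional.complete ℝ E
  have : CompleteSpace F := FiniteDimensional.complete ℝ F
  set A := fderiv ℝ φ w₀
  -- `P ∘ A` is injective because `⟪P (A v), v⟫ = ‖A v‖ ^ 2`. Hence `P` is onto, and by dimension
  -- its kernel is the line through `a`.
  let P : E →L[ℝ] F := ContinuousLinearMap.adjoint A
  have hPA : Function.Injective (P.comp A) := by
    refine (injective_iff_map_eq_zero _).2 fun v hv => hinj ?_
    have h1 : inner ℝ (P (A v)) v = 0 := by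
      rw [show P (A v) = 0 from hv, inner_zero_left]
    rw [ContinuousLinearMap.adjoint_inner_left, inner_self_eq_zero] at h1
    rw [h1, map_zero]
  let e : F ≃L[ℝ] F :=
    (LinearEquiv.ofInjectiveEndo (P.comp A : F →ₗ[ℝ] F) hPA).toContinuousLinearEquiv
  have he : (e : F →L[ℝ] F) = P.comp A := by ext; rfl
  have hker : ∀ x : E, P x = 0 → ∃ c : ℝ, x = c • a := by
    have hPa : P a = 0 := by
      refine ext_inner_right ℝ fun v => ?_
      rw [ContinuousLinearMap.adjoint_inner_left, ha, inner_zero_left]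
    have hsurj : LinearMap.range (P : E →ₗ[ℝ] F) = ⊤ := by
      refine LinearMap.range_eq_top.2 fun v => ⟨A (e.symm v), ?_⟩
      have : (e : F →L[ℝ] F) (e.symm v) = v := e.apply_symm_apply v
      rwa [he] at this
    have hrank := LinearMap.finrank_range_add_finrank_ker (P : E →ₗ[ℝ] F)
    rw [hsurj, finrank_top, hdim] at hrank
    have h1 : Module.finrank ℝ (LinearMap.ker (P : E →ₗ[ℝ] F)) = 1 := by omega
    intro x hx
    obtain ⟨c, hc⟩ := (finrank_eq_one_iff_of_nonzero'
      (⟨a, hPa⟩ : LinearMap.ker (P : E →ₗ[ℝ] F)) (fun h => ha0 (congrArg Subtype.val h))).1 h1 ⟨x, hx⟩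
    exact ⟨c, (congrArg Subtype.val hc).symm⟩
  have hPφ : ContDiffAt ℝ 1 (fun w => P (φ w)) w₀ := P.contDiff.contDiffAt.comp w₀ hφ
  have hPφ' : HasFDerivAt (fun w => P (φ w)) (e : F →L[ℝ] F) w₀ := by
    rw [he]
    exact P.hasFDerivAt.comp w₀ (hφ.differentiableAt (by simp)).hasFDerivAt
  -- With this choice `P (φ (ψ y)) = P y`, so the error `y - φ (ψ y)` lies in the kernel of `P`.
  refine ⟨fun y => hPφ.localInverse hPφ' (by simp) (P y), ?_, ?_, ?_⟩
  · exact (hPφ.to_localInverse hPφ' (by simp)).comp (φ w₀) P.contDiff.contDiffAt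
  · exact hPφ.localInverse_apply_image hPφ' (by simp)
  · have h1 := (hPφ.hasStrictFDerivAt' hPφ' (by simp)).eventually_right_inverse
    filter_upwards [P.continuous.continuousAt.eventually h1] with y hy
    refine hker _ ?_
    rw [map_sub, sub_eq_zero]
    exact hy.symm

/-! ### Calculus of local parametrizations -/

lemma IsCkOn.contDiffAt {k : WithTop ℕ∞} {N M : ℕ} {W : Set (EuclideanSpace ℝ (Fin N))}
    {φ : EuclideanSpace ℝ (Fin N) → EuclideanSpace ℝ (Fin M)} (h : IsCkOn k W φ) (hW : IsOpen W)
    {w : EuclideanSpace ℝ (Fin N)} (hw : w ∈ W) : ContDiffAt ℝ k φ w := by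
  obtain ⟨r, hr, F, hF, hFφ⟩ := h w hw
  refine (hF.contDiffAt (Metric.ball_mem_nhds w hr)).congr_of_eventuallyEq ?_
  filter_upwards [hW.mem_nhds hw, Metric.ball_mem_nhds w hr] with y hy hy'
  exact (hFφ y ⟨hy, hy'⟩).symm

namespace IsLocalParam

variable {k : WithTop ℕ∞} {m N : ℕ} {X O : Set (EuclideanSpace ℝ (Fin N))}
  {x : EuclideanSpace ℝ (Fin N)} {φ : EuclideanSpace ℝ (Fin m) → EuclideanSpace ℝ (Fin N)}
  {W : Set (EuclideanSpace ℝ (Fin m))} {w : EuclideanSpace ℝ (Fin m)}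

lemma contDiffAt (h : IsLocalParam k X x φ W O) (hw : w ∈ W) : ContDiffAt ℝ k φ w :=
  h.diffeo.2.1.contDiffAt h.isOpen_source hw

lemma apply_mem_target (h : IsLocalParam k X x φ W O) (hw : w ∈ W) : φ w ∈ O :=
  h.diffeo.1.mapsTo hw

lemma target_subset (h : IsLocalParam k X x φ W O) : O ⊆ X := by
  obtain ⟨G, -, rfl⟩ := h.relOpen_target
  exact inter_subset_left

lemma recenter (h : IsLocalParam k X x φ W O) (hw : w ∈ W) : IsLocalParam k X (φ w) φ W O :=
  ⟨h.isOpen_source, h.relOpen_target, h.apply_mem_target hw, h.diffeo⟩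

/-- `H` is an ambient extension of the inverse chart, hence differentiable in the usual sense.
Relative openness of `O` allows neighbourhoods in `X` instead of `O`. -/
lemma exists_leftInverse (h : IsLocalParam k X x φ W O) (hw : w ∈ W) :
    ∃ H : EuclideanSpace ℝ (Fin N) → EuclideanSpace ℝ (Fin m), ContDiffAt ℝ k H (φ w) ∧
      (∀ᶠ v in 𝓝 w, H (φ v) = v) ∧ ∀ᶠ y in 𝓝[X] (φ w), φ (H y) = y := by
  obtain ⟨i, hi, hik⟩ := h.diffeo.2.2
  obtain ⟨r, hr, H, hH, hHi⟩ := hik _ (h.apply_mem_target hw)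
  refine ⟨H, hH.contDiffAt (Metric.ball_mem_nhds _ hr), ?_, ?_⟩
  · filter_upwards [h.isOpen_source.mem_nhds hw,
      (h.contDiffAt hw).continuousAt.eventually (Metric.ball_mem_nhds _ hr)] with v hv hv'
    rw [hHi _ ⟨h.apply_mem_target hv, hv'⟩, hi.1 hv]
  · obtain ⟨G, hG, hO⟩ := h.relOpen_target
    have hwG : φ w ∈ G := (hO ▸ h.apply_mem_target hw : φ w ∈ X ∩ G).2
    filter_upwards [self_mem_nhdsWithin, nhdsWithin_le_nhds (hG.mem_nhds hwG),
      nhdsWithin_le_nhds (Metric.ball_mem_nhds (φ w) hr)] with y hyX hyG hyr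
    have hyO : y ∈ O := hO ▸ ⟨hyX, hyG⟩
    rw [hHi _ ⟨hyO, hyr⟩, hi.2 hyO]

/-- Chain rule for `H ∘ φ = id`; being an immersion is not part of the definition. -/
lemma injective_fderiv (h : IsLocalParam k X x φ W O) (hk : k ≠ 0) (hw : w ∈ W) :
    Function.Injective (fderiv ℝ φ w) := by
  obtain ⟨H, hH, hHφ, -⟩ := h.exists_leftInverse hw
  have h1 : HasFDerivAt (fun v => H (φ v)) ((fderiv ℝ H (φ w)).comp (fderiv ℝ φ w)) w :=
    (hH.differentiableAt hk).hasFDerivAt.comp w ((h.contDiffAt hw).differentiableAt hk).hasFDerivAt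
  have h2 : HasFDerivAt (fun v => H (φ v)) (ContinuousLinearMap.id ℝ _) w :=
    (hasFDerivAt_id w).congr_of_eventuallyEq hHφ
  have h3 := h1.unique h2
  exact Function.LeftInverse.injective (g := fderiv ℝ H (φ w)) fun v => DFunLike.congr_fun h3 v

lemma eventually_mem_image (h : IsLocalParam k X x φ W O) (hw : w ∈ W)
    {p : EuclideanSpace ℝ (Fin N) → Prop} (hp : ∀ᶠ v in 𝓝 w, p (φ v)) :
    ∀ᶠ y in 𝓝[X] (φ w), p y := by
  obtain ⟨H, hH, hHφ, hφH⟩ := h.exists_leftInverse hw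
  have hHw : H (φ w) = w := hHφ.self_of_nhds
  have h1 : Tendsto H (𝓝[X] (φ w)) (𝓝 w) := by
    simpa only [hHw] using hH.continuousAt.tendsto.mono_left nhdsWithin_le_nhds
  filter_upwards [h1.eventually hp, hφH] with y hy hy'
  rwa [hy'] at hy

lemma inner_fderiv_eq_zero
    {g : EuclideanSpace ℝ (Fin N) → EuclideanSpace ℝ (Fin N)}
    (h : IsLocalParam 1 X x φ W O) (hg : IsNormalField m X g) (hw : w ∈ W)
    (v : EuclideanSpace ℝ (Fin m)) : inner ℝ (g (φ w)) (fderiv ℝ φ w v) = 0 :=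
  hg _ (h.target_subset (h.apply_mem_target hw)) _
    ⟨φ, W, O, h.recenter hw, w, hw, rfl, mem_range_self v⟩

end IsLocalParam

/-- Two `C¹` hypersurfaces through `x`, both normal to the same nonzero Lipschitz field, agree
near `x`. -/
lemma eventually_mem_of_isNormalField {n : ℕ} {X Y : Set (EuclideanSpace ℝ (Fin n))}
    {g : EuclideanSpace ℝ (Fin n) → EuclideanSpace ℝ (Fin n)} {x : EuclideanSpace ℝ (Fin n)}
    (hX : IsCkManifold 1 (n - 1) X) (hY : IsCkManifold 1 (n - 1) Y)
    (hgX : IsNormalField (n - 1) X g) (hgY : IsNormalField (n - 1) Y g)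
    {s : Set (EuclideanSpace ℝ (Fin n))} {L : NNReal} (hs : s ∈ 𝓝 x) (hg : LipschitzOnWith L g s)
    (hg0 : g x ≠ 0) (hxX : x ∈ X) (hxY : x ∈ Y) : ∀ᶠ y in 𝓝[X] x, y ∈ Y := by
  -- Excludes the truncated value `0 - 1 = 0`, so that the codimension is really one.
  have hn : n ≠ 0 := by
    rintro rfl
    exact hg0 (Subsingleton.elim _ _)
  obtain ⟨φ, W, O, hφ⟩ := hX x hxX
  obtain ⟨φ', W', O', hφ'⟩ := hY x hxY
  obtain ⟨w, hw, rfl⟩ := hφ.diffeo.1.surjOn hφ.mem_target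
  obtain ⟨w', hw', hww'⟩ := hφ'.diffeo.1.surjOn hφ'.mem_target
  obtain ⟨ψ, hψ, hψ0, hψa⟩ := exists_projection_along_normal
    (by rw [finrank_euclideanSpace_fin, finrank_euclideanSpace_fin]; omega)
    (hφ'.contDiffAt hw') (hφ'.injective_fderiv (by simp) hw') (hww'.symm ▸ hg0)
    (hφ'.inner_fderiv_eq_zero hgY hw')
  rw [hww'] at hψ hψ0 hψa
  have hψW : ∀ᶠ y in 𝓝 (φ w), ψ y ∈ W' := by
    refine hψ.continuousAt.eventually ?_
    rw [hψ0]
    exact hφ'.isOpen_source.mem_nhds hw'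
  have hQ : ContDiffAt ℝ 1 (fun y => φ' (ψ y)) (φ w) :=
    ContDiffAt.comp (φ w) (by rw [hψ0]; exact hφ'.contDiffAt hw') hψ
  have hQn : ∀ᶠ y in 𝓝 (φ w), ∀ v,
      inner ℝ (g (φ' (ψ y))) (fderiv ℝ (fun y => φ' (ψ y)) y v) = 0 := by
    filter_upwards [hψW, hψ.eventually (by simp)] with y hy hy' v
    have h1 : HasFDerivAt (fun y => φ' (ψ y)) ((fderiv ℝ φ' (ψ y)).comp (fderiv ℝ ψ y)) y :=
      ((hφ'.contDiffAt hy).differentiableAt (by simp)).hasFDerivAt.comp y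
        (hy'.differentiableAt (by simp)).hasFDerivAt
    rw [h1.fderiv]
    exact hφ'.inner_fderiv_eq_zero hgY hy _
  refine hφ.eventually_mem_image hw ?_
  have hφn : ∀ᶠ v in 𝓝 w, ∀ z, inner ℝ (g (φ v)) (fderiv ℝ φ v z) = 0 := by
    filter_upwards [hφ.isOpen_source.mem_nhds hw] with v hv z
    exact hφ.inner_fderiv_eq_zero hgX hv z
  filter_upwards [eventually_retraction_eq hs hg hg0 (hφ.contDiffAt hw) hφn hQ
    (by simp only [hψ0, hww']) hQn hψa, (hφ.contDiffAt hw).continuousAt.eventually hψW] with v hv hv'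
  rw [← hv]
  exact hφ'.target_subset (hφ'.apply_mem_target hv')

lemma LocLipschitzOn.exists_mem_nhds {E F : Type*} [PseudoMetricSpace E] [ProperSpace E]
    [PseudoEMetricSpace F] {f : E → F} {U : Set E} (hf : LocLipschitzOn f U) (hU : IsOpen U)
    {x : E} (hx : x ∈ U) : ∃ s ∈ 𝓝 x, ∃ L : NNReal, LipschitzOnWith L f s := by
  obtain ⟨r, hr, hrU⟩ := Metric.nhds_basis_closedBall.mem_iff.1 (hU.mem_nhds hx)
  exact ⟨_, Metric.closedBall_mem_nhds x hr, hf _ hrU (isCompact_closedBall x r)⟩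

/-! ### Normal solutions and their level sets -/

namespace IsNormalSolution

variable {n : ℕ} {U V : Set (EuclideanSpace ℝ (Fin n))}
  {g : EuclideanSpace ℝ (Fin n) → EuclideanSpace ℝ (Fin n)}
  {u u₁ u₂ : EuclideanSpace ℝ (Fin n) → ℝ}

lemma continuousAt (h : IsNormalSolution U g V u) {x : EuclideanSpace ℝ (Fin n)} (hx : x ∈ V) :
    ContinuousAt u x := by
  obtain ⟨s, hs, L, hL⟩ := h.locLipschitz.exists_mem_nhds h.isOpen_domain hx
  exact hL.continuousOn.continuousAt hs

lemma continuousOn (h : IsNormalSolution U g V u) : ContinuousOn u V :=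
  fun _ hx => (h.continuousAt hx).continuousWithinAt

/-- Having no local extrema, a normal solution is an open map. -/
lemma image_mem_nhds (h : IsNormalSolution U g V u) {x : EuclideanSpace ℝ (Fin n)} (hx : x ∈ V)
    {s : Set (EuclideanSpace ℝ (Fin n))} (hs : s ∈ 𝓝 x) : u '' s ∈ 𝓝 (u x) := by
  obtain ⟨r, hr, hrs⟩ := Metric.nhds_basis_ball.mem_iff.1
    (Filter.inter_mem hs (h.isOpen_domain.mem_nhds hx))
  have hball : Metric.ball x r ∈ 𝓝 x := Metric.ball_mem_nhds x hr
  obtain ⟨y, hy, hxy⟩ : ∃ y ∈ Metric.ball x r, u x < u y := by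
    by_contra! hcon
    exact h.no_localMax x hx (Filter.mem_of_superset hball hcon)
  obtain ⟨z, hz, hzx⟩ : ∃ z ∈ Metric.ball x r, u z < u x := by
    by_contra! hcon
    exact h.no_localMin x hx (Filter.mem_of_superset hball hcon)
  have hconn : IsPreconnected (u '' Metric.ball x r) :=
    (convex_ball x r).isPreconnected.image u (h.continuousOn.mono fun w hw => (hrs hw).2)
  have hsub : Icc (u z) (u y) ⊆ u '' Metric.ball x r :=
    hconn.Icc_subset (mem_image_of_mem u hz) (mem_image_of_mem u hy)
  exact Filter.mem_of_superset (Icc_mem_nhds hzx hxy)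
    (hsub.trans (image_mono fun w hw => (hrs hw).1))

/-- A normal solution is constant on every connected level set of another one. -/
lemma eq_of_eq (hU : IsOpen U) (hg : LocLipschitzOn g U) (hg0 : ∀ x ∈ U, g x ≠ 0)
    (h₁ : IsNormalSolution U g V u₁) (h₂ : IsNormalSolution U g V u₂)
    (hc₁ : ∀ c : ℝ, IsPreconnected (levelSet V u₁ c)) {x y : EuclideanSpace ℝ (Fin n)}
    (hx : x ∈ V) (hy : y ∈ V) (hxy : u₁ x = u₁ y) : u₂ x = u₂ y := by
  -- A transitive symmetric relation that holds locally on a preconnected set holds throughout it.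
  refine (hc₁ (u₁ y)).induction₂ (fun x y => u₂ x = u₂ y) ?_
    (fun _ _ _ _ _ _ h h' => h.trans h') (fun _ _ _ _ h => h.symm) ⟨hx, hxy⟩ ⟨hy, rfl⟩
  rintro z ⟨hz, hzy⟩
  obtain ⟨s, hs, L, hL⟩ := hg.exists_mem_nhds hU (h₁.domain_subset hz)
  filter_upwards [eventually_mem_of_isNormalField (h₁.manifold_levelSet (u₁ y))
    (h₂.manifold_levelSet (u₂ z)) (h₁.normal_levelSet (u₁ y)) (h₂.normal_levelSet (u₂ z)) hs hL
    (hg0 z (h₁.domain_subset hz)) ⟨hz, hzy⟩ ⟨hz, rfl⟩] with w hw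
  exact hw.2.symm

end IsNormalSolution

lemma ContinuousOn.strictMonoOn_or_strictAntiOn {f : ℝ → ℝ} {s : Set ℝ} (hs : IsPreconnected s)
    (hf : ContinuousOn f s) (hinj : InjOn f s) : StrictMonoOn f s ∨ StrictAntiOn f s := by
  rcases s.eq_empty_or_nonempty with rfl | hne
  · exact Or.inl fun x hx => hx.elim
  have : OrdConnected s := hs.ordConnected
  have : Inhabited s := ⟨⟨_, hne.some_mem⟩⟩
  have := Continuous.strictMono_of_inj hf.domRestrict hinj.injective
  exact this.imp strictMono_domRestrict.mp strictAntiOn_iff_strictAnti.mpr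

end TDE

theorem mainTheorem7 (n : ℕ) (U : Set (EuclideanSpace ℝ (Fin n))) (hU : IsOpen U)
    (g : EuclideanSpace ℝ (Fin n) → EuclideanSpace ℝ (Fin n))
    (hg : TDE.LocLipschitzOn g U) (hg0 : ∀ x ∈ U, g x ≠ 0)
    (V : Set (EuclideanSpace ℝ (Fin n))) (hV : IsPreconnected V)
    (u₁ u₂ : EuclideanSpace ℝ (Fin n) → ℝ)
    (h₁ : TDE.IsNormalSolution U g V u₁) (h₂ : TDE.IsNormalSolution U g V u₂)
    (hc₁ : ∀ c : ℝ, IsPreconnected (TDE.levelSet V u₁ c))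
    (hc₂ : ∀ c : ℝ, IsPreconnected (TDE.levelSet V u₂ c)) :
    TDE.IsMonotoneTransformOn V u₁ u₂ := by
  have h12 : ∀ {x y}, x ∈ V → y ∈ V → u₁ x = u₁ y → u₂ x = u₂ y :=
    fun hx hy => h₁.eq_of_eq hU hg hg0 h₂ hc₁ hx hy
  have h21 : ∀ {x y}, x ∈ V → y ∈ V → u₂ x = u₂ y → u₁ x = u₁ y :=
    fun hx hy => h₂.eq_of_eq hU hg hg0 h₁ hc₂ hx hy
  let φ : ℝ → ℝ := fun c => u₂ (Function.invFunOn u₁ V c)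
  have hφ : ∀ x ∈ V, u₂ x = φ (u₁ x) := fun x hx =>
    (h12 (Function.invFunOn_mem ⟨x, hx, rfl⟩) hx (Function.invFunOn_eq ⟨x, hx, rfl⟩)).symm
  refine ⟨φ, TDE.ContinuousOn.strictMonoOn_or_strictAntiOn (hV.image u₁ h₁.continuousOn) ?_ ?_, hφ⟩
  · rintro _ ⟨x, hx, rfl⟩
    intro t ht
    rw [← hφ x hx] at ht
    -- Openness of `u₁` sends this neighbourhood of `x` to one of `u₁ x`, on which `φ` takes values
    -- in `t`.
    have hpre : u₂ ⁻¹' t ∩ V ∈ nhds x :=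
      Filter.inter_mem ((h₂.continuousAt hx) ht) (h₁.isOpen_domain.mem_nhds hx)
    refine mem_nhdsWithin_of_mem_nhds (Filter.mem_of_superset (h₁.image_mem_nhds hx hpre) ?_)
    rintro _ ⟨y, ⟨hyt, hyV⟩, rfl⟩
    rw [mem_preimage, ← hφ y hyV]
    exact hyt
  · rintro _ ⟨x, hx, rfl⟩ _ ⟨y, hy, rfl⟩ hxy
    rw [← hφ x hx, ← hφ y hy] at hxy
    exact h21 hx hy hxy
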